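/- Let $\Phi_1$ and $\Phi_2$ be quantum channels on an $n$-level system, i.e. completely positive trace preserving linear maps on the complex $n\times n$ matrices. For a density matrix $\rho$ let $S(\rho) = -\operatorname{tr}\rho\log\rho$ be its von Neumann entropy, and let the map entropy of a channel $\Phi$ be $S^{\mathrm{map}}(\Phi) := S(\sigma^\Phi)$, where $\sigma^\Phi := (\Phi\otimes\mathrm{id})(|\phi_+\rangle\langle\phi_+|)$ and $|\phi_+\rangle := \frac{1}{\sqrt n}\sum_{i=1}^n |i\rangle\otimes|i\rangle$. Then for every maximally entangled state $|\psi_+\rangle\in\mathbb{C}^n\otimes\mathbb{C}^n$, i.e. every vector of the form $\frac{1}{\sqrt n}\sum_{k=1}^n |e_k\rangle\otimes|f_k\rangle$ with orthonormal bases $(e_k)$ and $(f_k)$ of $\mathbb{C}^n$, $$\bigl| S^{\mathrm{map}}(\Phi_1) - S^{\mathrm{map}}(\Phi_2) \bigr| \le S\bigl( (\Phi_1\otimes\Phi_2)(|\psi_+\rangle\langle\psi_+|) \bigr) \le S^{\mathrm{map}}(\Phi_1) + S^{\mathrm{map}}(\Phi_2).$$ -/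

import Mathlib

open scoped Kronecker ComplexOrder

noncomputable section

namespace QuantumChannel

/-- The tensor product `Φ ⊗ Ψ` of two linear maps on matrix algebras, acting on matrices indexed by
pairs, through the identification of `A ⊗ B` with the Kronecker product of `A` and `B`. -/
def tensorMap {a b : Type*} [Fintype a] [DecidableEq a] [Fintype b] [DecidableEq b]
    (Φ : Matrix a a ℂ →ₗ[ℂ] Matrix a a ℂ) (Ψ : Matrix b b ℂ →ₗ[ℂ] Matrix b b ℂ) :
    Matrix (a × b) (a × b) ℂ →ₗ[ℂ] Matrix (a × b) (a × b) ℂ :=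
  (kroneckerLinearEquiv a a b b ℂ).toLinearMap ∘ₗ TensorProduct.map Φ Ψ ∘ₗ
    (kroneckerLinearEquiv a a b b ℂ).symm.toLinearMap

/-- The characteristic property of the tensor product of maps. -/
theorem tensorMap_kronecker {a b : Type*} [Fintype a] [DecidableEq a] [Fintype b] [DecidableEq b]
    (Φ : Matrix a a ℂ →ₗ[ℂ] Matrix a a ℂ) (Ψ : Matrix b b ℂ →ₗ[ℂ] Matrix b b ℂ)
    (A : Matrix a a ℂ) (B : Matrix b b ℂ) :
    tensorMap Φ Ψ (A ⊗ₖ B) = Φ A ⊗ₖ Ψ B := by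
  simp [tensorMap]

/-- Complete positivity: for every `m`, the map `Φ ⊗ id_m` sends positive semidefinite matrices to
positive semidefinite matrices. -/
def IsCompletelyPositive {n : ℕ} (Φ : Matrix (Fin n) (Fin n) ℂ →ₗ[ℂ] Matrix (Fin n) (Fin n) ℂ) :
    Prop :=
  ∀ (m : ℕ) (X : Matrix (Fin n × Fin m) (Fin n × Fin m) ℂ), X.PosSemidef →
    (tensorMap Φ (LinearMap.id : Matrix (Fin m) (Fin m) ℂ →ₗ[ℂ] Matrix (Fin m) (Fin m) ℂ)
      X).PosSemidef

/-- A quantum channel on an `n`-level system: a completely positive, trace preserving linear map. -/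
structure IsChannel {n : ℕ} (Φ : Matrix (Fin n) (Fin n) ℂ →ₗ[ℂ] Matrix (Fin n) (Fin n) ℂ) :
    Prop where
  completelyPositive : IsCompletelyPositive Φ
  trace_preserving : ∀ X : Matrix (Fin n) (Fin n) ℂ, (Φ X).trace = X.trace

/-- The rank-one operator `|ψ⟩⟨ψ|`. -/
def ketbra {ι : Type*} (ψ : ι → ℂ) : Matrix ι ι ℂ :=
  Matrix.vecMulVec ψ (star ψ)

/-- The standard vector `|φ₊⟩ = n^{-1/2} ∑ᵢ |i⟩ ⊗ |i⟩` of `ℂⁿ ⊗ ℂⁿ`. -/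
def phiPlus (n : ℕ) : Fin n × Fin n → ℂ :=
  fun p => if p.1 = p.2 then ((1 / Real.sqrt n : ℝ) : ℂ) else 0

/-- A vector `ψ` of `ℂⁿ ⊗ ℂⁿ` is maximally entangled if all its Schmidt coefficients are equal:
`ψ = n^{-1/2} ∑ₖ |eₖ⟩ ⊗ |fₖ⟩` for some orthonormal bases `e`, `f` of `ℂⁿ`. -/
def IsMaximallyEntangled {n : ℕ} (ψ : Fin n × Fin n → ℂ) : Prop :=
  ∃ e f : OrthonormalBasis (Fin n) ℂ (EuclideanSpace ℂ (Fin n)),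
    ∀ p : Fin n × Fin n, ψ p = ((1 / Real.sqrt n : ℝ) : ℂ) * ∑ k : Fin n, e k p.1 * f k p.2

/-- The von Neumann entropy `S(ρ) = -tr (ρ log ρ)`, with the natural logarithm of the Hermitian
matrix `ρ` taken through the functional calculus (and `0 log 0 = 0`). -/
def vonNeumannEntropy {ι : Type*} [Fintype ι] [DecidableEq ι] (ρ : Matrix ι ι ℂ) : ℝ :=
  -((ρ * cfc Real.log ρ).trace).re

/-- The Jamiołkowski state `σ^Φ = (Φ ⊗ id)(|φ₊⟩⟨φ₊|)`. -/
def jamiolkowskiState {n : ℕ} (Φ : Matrix (Fin n) (Fin n) ℂ →ₗ[ℂ] Matrix (Fin n) (Fin n) ℂ) :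
    Matrix (Fin n × Fin n) (Fin n × Fin n) ℂ :=
  tensorMap Φ LinearMap.id (ketbra (phiPlus n))

/-- The map entropy `S^map(Φ) = S(σ^Φ)`. -/
def mapEntropy {n : ℕ} (Φ : Matrix (Fin n) (Fin n) ℂ →ₗ[ℂ] Matrix (Fin n) (Fin n) ℂ) : ℝ :=
  vonNeumannEntropy (jamiolkowskiState Φ)

end QuantumChannel

end

/-! Choose Kraus operators `A k` of `Φ₁` and `B l` of `Φ₂`. The numbers `((A k ⊗ₖ B l) *ᵥ ψ) r` are
the coefficients of a pure state on output, first environment and second environment. Its output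
marginal is `(Φ₁ ⊗ Φ₂)(|ψ⟩⟨ψ|)`. Since `ψ` has a coefficient matrix proportional to a unitary and
the channels preserve trace, the environment marginals are the normalized Gram matrices of the Kraus
families. For the Kraus operators obtained by reshaping a factorization `M * Mᴴ` of the Jamiołkowski
state, the Gram matrix is `(Mᴴ * M)ᵀ`, so its entropy is the map entropy.

Both bounds are then the triangle inequality for three parties in a pure state
(`vonNeumannEntropy_reducedState_le`), applied once to each party. It combines subadditivity of the
entropy with the equality of the entropies of complementary marginals. Subadditivity follows from
the Shannon case by passing to eigenbases of the two marginals and pinching. -/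

namespace QuantumChannel

open Matrix Real

/-! ### Entropy in terms of the spectrum, and pinching -/

section Entropy

variable {ι κ : Type*} [Fintype ι] [DecidableEq ι] [Fintype κ] [DecidableEq κ]

theorem vonNeumannEntropy_eq_sum_eigenvalues {ρ : Matrix ι ι ℂ} (hρ : ρ.IsHermitian) :
    vonNeumannEntropy ρ = ∑ i, negMulLog (hρ.eigenvalues i) := by
  have hsa : IsSelfAdjoint ρ := hρ
  have h1 : ρ * cfc Real.log ρ = cfc (fun x : ℝ => x * Real.log x) ρ := by
    -- The spectrum is finite, so the discontinuity of `log` at 0 is harmless.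
    have hc : ∀ f : ℝ → ℝ, ContinuousOn f (spectrum ℝ ρ) := fun f =>
      Matrix.finite_real_spectrum.continuousOn f
    conv_lhs => enter [1]; rw [← cfc_id ℝ ρ hsa]
    rw [← cfc_mul _ _ ρ (hc _) (hc _)]
    rfl
  have h2 : (cfc (fun x : ℝ => x * Real.log x) ρ).trace =
      ∑ i, ((hρ.eigenvalues i * Real.log (hρ.eigenvalues i) : ℝ) : ℂ) := by
    rw [hρ.cfc_eq, Matrix.IsHermitian.cfc, Unitary.conjStarAlgAut_apply, Matrix.trace_mul_comm,
      ← mul_assoc]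
    simp [Matrix.trace]
  rw [vonNeumannEntropy, h1, h2, ← Complex.ofReal_sum, Complex.ofReal_re, ← Finset.sum_neg_distrib]
  simp [negMulLog]

/-- In this form invariances of the entropy reduce to identities between characteristic polynomials,
with no eigenvectors to match. -/
theorem vonNeumannEntropy_eq_sum_roots_charpoly {ρ : Matrix ι ι ℂ} (hρ : ρ.IsHermitian) :
    vonNeumannEntropy ρ = (ρ.charpoly.roots.map fun z => negMulLog z.re).sum := by
  rw [vonNeumannEntropy_eq_sum_eigenvalues hρ, hρ.roots_charpoly_eq_eigenvalues]
  simp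

theorem vonNeumannEntropy_transpose {ρ : Matrix ι ι ℂ} (hρ : ρ.IsHermitian) :
    vonNeumannEntropy ρᵀ = vonNeumannEntropy ρ := by
  rw [vonNeumannEntropy_eq_sum_roots_charpoly hρ,
    vonNeumannEntropy_eq_sum_roots_charpoly hρ.transpose, Matrix.charpoly_transpose]

/-- The two products, possibly of different sizes, share their nonzero eigenvalues with
multiplicity; the surplus zeros contribute `negMulLog 0 = 0`. -/
theorem vonNeumannEntropy_mul_comm (A : Matrix ι κ ℂ) (B : Matrix κ ι ℂ)
    (hAB : (A * B).IsHermitian) (hBA : (B * A).IsHermitian) :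
    vonNeumannEntropy (A * B) = vonNeumannEntropy (B * A) := by
  rw [vonNeumannEntropy_eq_sum_roots_charpoly hAB, vonNeumannEntropy_eq_sum_roots_charpoly hBA]
  have h := congrArg (fun p : Polynomial ℂ => (p.roots.map fun z => negMulLog z.re).sum)
    (Matrix.charpoly_mul_comm' A B)
  have hX : ∀ m : ℕ, (Polynomial.X : Polynomial ℂ) ^ m ≠ 0 := fun m =>
    pow_ne_zero _ Polynomial.X_ne_zero
  rw [Polynomial.roots_mul (mul_ne_zero (hX _) (Matrix.charpoly_monic _).ne_zero),
    Polynomial.roots_mul (mul_ne_zero (hX _) (Matrix.charpoly_monic _).ne_zero)] at h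
  simpa [Multiset.map_nsmul, Multiset.sum_nsmul] using h

theorem vonNeumannEntropy_unitary_conj {ρ U : Matrix ι ι ℂ} (hρ : ρ.IsHermitian)
    (hU : U * Uᴴ = 1) : vonNeumannEntropy (Uᴴ * ρ * U) = vonNeumannEntropy ρ := by
  have h : U * (Uᴴ * ρ) = ρ := by rw [← mul_assoc, hU, one_mul]
  rw [vonNeumannEntropy_mul_comm (Uᴴ * ρ) U (isHermitian_conjTranspose_mul_mul U hρ)
    (by rwa [h]), h]

/-- Pinching to the diagonal does not decrease the entropy. -/
theorem vonNeumannEntropy_le_sum_diag {ρ : Matrix ι ι ℂ} (hρ : ρ.PosSemidef) :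
    vonNeumannEntropy ρ ≤ ∑ i, negMulLog (ρ i i).re := by
  have hH := hρ.isHermitian
  set U : Matrix ι ι ℂ := (hH.eigenvectorUnitary : Matrix ι ι ℂ) with hUdef
  have hU1 : U * Uᴴ = 1 := Unitary.coe_mul_star_self hH.eigenvectorUnitary
  have hU2 : Uᴴ * U = 1 := Unitary.coe_star_mul_self hH.eigenvectorUnitary
  -- The weights `|U i l|²` are doubly stochastic: row sums make them Jensen weights, column sums
  -- recover the entropy after summation over `i`.
  have hrow : ∀ i, ∑ l, Complex.normSq (U i l) = 1 := fun i => by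
    have := congrFun (congrFun hU1 i) i
    simp only [Matrix.mul_apply, conjTranspose_apply, one_apply_eq, RCLike.star_def,
      Complex.mul_conj] at this
    exact_mod_cast this
  have hcol : ∀ l, ∑ i, Complex.normSq (U i l) = 1 := fun l => by
    have := congrFun (congrFun hU2 l) l
    simp only [Matrix.mul_apply, conjTranspose_apply, one_apply_eq, RCLike.star_def,
      ← Complex.normSq_eq_conj_mul_self] at this
    exact_mod_cast this
  have hdiag : ∀ i, (ρ i i).re = ∑ l, Complex.normSq (U i l) • hH.eigenvalues l := fun i => by
    have h : ρ = U * diagonal (RCLike.ofReal ∘ hH.eigenvalues) * Uᴴ := hH.spectral_theorem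
    have h2 : ρ i i = ((∑ l, Complex.normSq (U i l) • hH.eigenvalues l : ℝ) : ℂ) := by
      conv_lhs => rw [h]
      rw [Matrix.mul_apply]
      push_cast
      refine Finset.sum_congr rfl fun l _ => ?_
      rw [mul_diagonal, conjTranspose_apply, RCLike.star_def, smul_eq_mul, Complex.ofReal_mul,
        ← Complex.mul_conj]
      simp only [Function.comp_apply, Complex.coe_algebraMap]
      ring
    rw [h2, Complex.ofReal_re]
  rw [vonNeumannEntropy_eq_sum_eigenvalues hH]
  calc ∑ l, negMulLog (hH.eigenvalues l)
      = ∑ i, ∑ l, Complex.normSq (U i l) • negMulLog (hH.eigenvalues l) := by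
        rw [Finset.sum_comm]
        simp only [smul_eq_mul, ← Finset.sum_mul, hcol, one_mul]
    _ ≤ _ := Finset.sum_le_sum fun i _ => by
        rw [hdiag]
        exact concaveOn_negMulLog.le_map_sum (fun l _ => Complex.normSq_nonneg _) (hrow i)
          fun l _ => hρ.eigenvalues_nonneg l

end Entropy

/-- Subadditivity of the Shannon entropy. -/
theorem sum_negMulLog_le_add {β γ : Type*} [Fintype β] [Fintype γ] (p : β → γ → ℝ)
    (hp : ∀ j k, 0 ≤ p j k) (h1 : ∑ j, ∑ k, p j k = 1) :
    ∑ j, ∑ k, negMulLog (p j k) ≤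
      ∑ j, negMulLog (∑ k, p j k) + ∑ k, negMulLog (∑ j, p j k) := by
  set q : β → ℝ := fun j => ∑ k, p j k with hq
  set r : γ → ℝ := fun k => ∑ j, p j k with hr
  have hr1 : ∑ k, r k = 1 := by rw [← h1]; exact Finset.sum_comm
  -- This is `log x ≤ x - 1` at `x = q j * r k / p j k`, multiplied by `p j k`; the correction `q j
  -- * r k - p j k` sums to zero.
  have hterm : ∀ j k, negMulLog (p j k) ≤
      (-(p j k * Real.log (q j)) - p j k * Real.log (r k)) + (q j * r k - p j k) := by
    intro j k
    have hqn : p j k ≤ q j := Finset.single_le_sum (fun k _ => hp j k) (Finset.mem_univ k)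
    have hrn : p j k ≤ r k :=
      Finset.single_le_sum (f := fun j => p j k) (fun j _ => hp j k) (Finset.mem_univ j)
    rcases (hp j k).eq_or_lt with h0 | h0
    · rw [← h0] at hqn hrn ⊢
      simpa using mul_nonneg hqn hrn
    · have hq0 := h0.trans_le hqn
      have hr0 := h0.trans_le hrn
      have hlog := Real.log_le_sub_one_of_pos (div_pos (mul_pos hq0 hr0) h0)
      rw [Real.log_div (mul_pos hq0 hr0).ne' h0.ne', Real.log_mul hq0.ne' hr0.ne'] at hlog
      have := mul_le_mul_of_nonneg_left hlog h0.le
      rw [mul_sub, mul_sub, mul_add, mul_div_cancel₀ _ h0.ne'] at this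
      rw [negMulLog]
      linarith
  have hqs : ∑ j, ∑ k, p j k * Real.log (q j) = ∑ j, q j * Real.log (q j) := by
    simp only [← Finset.sum_mul, hq]
  have hrs : ∑ j, ∑ k, p j k * Real.log (r k) = ∑ k, r k * Real.log (r k) := by
    rw [Finset.sum_comm]
    simp only [← Finset.sum_mul, hr]
  have hqr : ∑ j, ∑ k, q j * r k = 1 := by
    rw [← Finset.sum_mul_sum, hr1, h1, one_mul]
  refine (Finset.sum_le_sum fun j _ => Finset.sum_le_sum fun k _ => hterm j k).trans ?_
  simp only [Finset.sum_add_distrib, Finset.sum_sub_distrib, Finset.sum_neg_distrib, hqs, hrs, hqr,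
    negMulLog, neg_mul]
  linarith

/-! ### Partial traces and subadditivity -/

section PartialTrace

variable {β γ : Type*}

/-- The partial trace over the second factor. -/
def partialTraceSnd [Fintype γ] (ρ : Matrix (β × γ) (β × γ) ℂ) : Matrix β β ℂ :=
  Matrix.of fun j j' => ∑ k, ρ (j, k) (j', k)

/-- The partial trace over the first factor. -/
def partialTraceFst [Fintype β] (ρ : Matrix (β × γ) (β × γ) ℂ) : Matrix γ γ ℂ :=
  Matrix.of fun k k' => ∑ j, ρ (j, k) (j, k')

theorem partialTraceSnd_add [Fintype γ] (X Y : Matrix (β × γ) (β × γ) ℂ) :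
    partialTraceSnd (X + Y) = partialTraceSnd X + partialTraceSnd Y := by
  ext; simp [partialTraceSnd, Finset.sum_add_distrib]

theorem partialTraceFst_add [Fintype β] (X Y : Matrix (β × γ) (β × γ) ℂ) :
    partialTraceFst (X + Y) = partialTraceFst X + partialTraceFst Y := by
  ext; simp [partialTraceFst, Finset.sum_add_distrib]

theorem partialTraceSnd_kronecker [Fintype γ] (A : Matrix β β ℂ) (B : Matrix γ γ ℂ) :
    partialTraceSnd (A ⊗ₖ B) = B.trace • A := by
  ext; simp [partialTraceSnd, Matrix.trace, ← Finset.mul_sum, mul_comm]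

theorem partialTraceFst_kronecker [Fintype β] (A : Matrix β β ℂ) (B : Matrix γ γ ℂ) :
    partialTraceFst (A ⊗ₖ B) = A.trace • B := by
  ext; simp [partialTraceFst, Matrix.trace, ← Finset.sum_mul]

theorem partialTraceSnd_isHermitian [Fintype γ] {ρ : Matrix (β × γ) (β × γ) ℂ}
    (hρ : ρ.IsHermitian) :
    (partialTraceSnd ρ).IsHermitian := by
  ext j j'
  simp only [partialTraceSnd, conjTranspose_apply, of_apply, star_sum]
  exact Finset.sum_congr rfl fun k _ => hρ.apply _ _

theorem partialTraceFst_isHermitian [Fintype β] {ρ : Matrix (β × γ) (β × γ) ℂ}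
    (hρ : ρ.IsHermitian) :
    (partialTraceFst ρ).IsHermitian := by
  ext j j'
  simp only [partialTraceFst, conjTranspose_apply, of_apply, star_sum]
  exact Finset.sum_congr rfl fun k _ => hρ.apply _ _

end PartialTrace

section Subadditivity

variable {β γ : Type*} [Fintype β] [DecidableEq β] [Fintype γ] [DecidableEq γ]

/-- Kronecker products span, so linear identities need checking only on them. -/
theorem kronecker_induction {P : Matrix (β × γ) (β × γ) ℂ → Prop} (h0 : P 0)
    (hk : ∀ A B, P (A ⊗ₖ B)) (hadd : ∀ X Y, P X → P Y → P (X + Y)) (X : Matrix (β × γ) (β × γ) ℂ) :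
    P X := by
  obtain ⟨t, rfl⟩ := (kroneckerLinearEquiv β β γ γ ℂ).surjective X
  induction t with
  | zero => simpa using h0
  | tmul A B => simpa using hk A B
  | add x y hx hy => simpa using hadd _ _ hx hy

theorem partialTraceSnd_unitary_conj (U : Matrix β β ℂ) {V : Matrix γ γ ℂ} (hV : V * Vᴴ = 1)
    (ρ : Matrix (β × γ) (β × γ) ℂ) :
    partialTraceSnd ((U ⊗ₖ V)ᴴ * ρ * (U ⊗ₖ V)) = Uᴴ * partialTraceSnd ρ * U := by
  induction ρ using kronecker_induction with
  | h0 => ext; simp [partialTraceSnd, Matrix.mul_apply]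
  | hk A B =>
    rw [conjTranspose_kronecker, ← mul_kronecker_mul, ← mul_kronecker_mul,
      partialTraceSnd_kronecker, partialTraceSnd_kronecker, Matrix.trace_mul_comm, ← mul_assoc, hV]
    simp
  | hadd X Y hX hY => simp only [mul_add, add_mul, partialTraceSnd_add, hX, hY]

theorem partialTraceFst_unitary_conj {U : Matrix β β ℂ} (hU : U * Uᴴ = 1) (V : Matrix γ γ ℂ)
    (ρ : Matrix (β × γ) (β × γ) ℂ) :
    partialTraceFst ((U ⊗ₖ V)ᴴ * ρ * (U ⊗ₖ V)) = Vᴴ * partialTraceFst ρ * V := by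
  induction ρ using kronecker_induction with
  | h0 => ext; simp [partialTraceFst, Matrix.mul_apply]
  | hk A B =>
    rw [conjTranspose_kronecker, ← mul_kronecker_mul, ← mul_kronecker_mul,
      partialTraceFst_kronecker, partialTraceFst_kronecker, Matrix.trace_mul_comm, ← mul_assoc, hU]
    simp
  | hadd X Y hX hY => simp only [mul_add, add_mul, partialTraceFst_add, hX, hY]

/-- Subadditivity of the von Neumann entropy. -/
theorem vonNeumannEntropy_subadditive {ρ : Matrix (β × γ) (β × γ) ℂ} (hρ : ρ.PosSemidef)
    (htr : ρ.trace = 1) :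
    vonNeumannEntropy ρ ≤
      vonNeumannEntropy (partialTraceSnd ρ) + vonNeumannEntropy (partialTraceFst ρ) := by
  have hβ := partialTraceSnd_isHermitian hρ.isHermitian
  have hγ := partialTraceFst_isHermitian hρ.isHermitian
  set U : Matrix β β ℂ := (hβ.eigenvectorUnitary : Matrix β β ℂ) with hUdef
  set V : Matrix γ γ ℂ := (hγ.eigenvectorUnitary : Matrix γ γ ℂ) with hVdef
  have hU : U * Uᴴ = 1 := Unitary.coe_mul_star_self hβ.eigenvectorUnitary
  have hV : V * Vᴴ = 1 := Unitary.coe_mul_star_self hγ.eigenvectorUnitary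
  have hUd : Uᴴ * partialTraceSnd ρ * U = diagonal (RCLike.ofReal ∘ hβ.eigenvalues) := by
    simpa [Unitary.conjStarAlgAut_apply, star_eq_conjTranspose, hUdef] using hβ.conjStarAlgAut_star_eigenvectorUnitary
  have hVd : Vᴴ * partialTraceFst ρ * V = diagonal (RCLike.ofReal ∘ hγ.eigenvalues) := by
    simpa [Unitary.conjStarAlgAut_apply, star_eq_conjTranspose, hVdef] using hγ.conjStarAlgAut_star_eigenvectorUnitary
  have hUV : (U ⊗ₖ V) * (U ⊗ₖ V)ᴴ = 1 := by
    rw [conjTranspose_kronecker, ← mul_kronecker_mul, hU, hV, one_kronecker_one]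
  -- In the product of the marginals' eigenbases, the diagonal is a joint distribution whose
  -- marginals are exactly the two spectra.
  set τ := (U ⊗ₖ V)ᴴ * ρ * (U ⊗ₖ V) with hτdef
  have hτ : τ.PosSemidef := hρ.conjTranspose_mul_mul_same _
  have hsnd : ∀ j, ∑ k, (τ (j, k) (j, k)).re = hβ.eigenvalues j := fun j => by
    have := congrArg Complex.re
      (congrFun (congrFun ((partialTraceSnd_unitary_conj U hV ρ).trans hUd) j) j)
    simpa [partialTraceSnd] using this
  have hfst : ∀ k, ∑ j, (τ (j, k) (j, k)).re = hγ.eigenvalues k := fun k => by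
    have := congrArg Complex.re
      (congrFun (congrFun ((partialTraceFst_unitary_conj hU V ρ).trans hVd) k) k)
    simpa [partialTraceFst] using this
  have hτtr : ∑ j, ∑ k, (τ (j, k) (j, k)).re = 1 := by
    have : τ.trace = 1 := by
      rw [hτdef, Matrix.trace_mul_comm, ← mul_assoc, hUV, one_mul, htr]
    have := congrArg Complex.re this
    simpa [Matrix.trace, Fintype.sum_prod_type] using this
  rw [← vonNeumannEntropy_unitary_conj hρ.isHermitian hUV,
    vonNeumannEntropy_eq_sum_eigenvalues hβ, vonNeumannEntropy_eq_sum_eigenvalues hγ]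
  refine (vonNeumannEntropy_le_sum_diag hτ).trans ?_
  rw [Fintype.sum_prod_type]
  have h := sum_negMulLog_le_add (fun j k => (τ (j, k) (j, k)).re)
    (fun j k => (Complex.nonneg_iff.mp hτ.diag_nonneg).1) hτtr
  simpa only [hsnd, hfst] using h

end Subadditivity

/-! ### Pure tripartite states -/

section Tripartite

variable {α β γ : Type*} [Fintype α] [DecidableEq α] [Fintype β] [DecidableEq β]
  [Fintype γ] [DecidableEq γ]

/-- The reduced density matrix on the first factor of the pure tripartite state with
coefficients `T`. -/
def reducedState (T : α → β → γ → ℂ) : Matrix α α ℂ :=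
  Matrix.of fun i i' => ∑ j, ∑ k, T i j k * star (T i' j k)

/-- For a pure tripartite state, the entropy of one party is at most the sum of the entropies of
the two others. -/
theorem vonNeumannEntropy_reducedState_le (T : α → β → γ → ℂ)
    (hT : ∑ i, ∑ j, ∑ k, T i j k * star (T i j k) = 1) :
    vonNeumannEntropy (reducedState T) ≤
      vonNeumannEntropy (reducedState fun j k i => T i j k) +
        vonNeumannEntropy (reducedState fun k i j => T i j k) := by
  set M : Matrix α (β × γ) ℂ := Matrix.of fun i p => T i p.1 p.2 with hM
  have h1 : reducedState T = M * Mᴴ := by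
    ext i i'
    simp [reducedState, Matrix.mul_apply, Fintype.sum_prod_type, hM]
  -- The marginal on the other two parties is the transpose of `Mᴴ * M`, because `reducedState`
  -- conjugates its second index.
  have hps : (Mᴴ * M)ᵀ.PosSemidef := (posSemidef_conjTranspose_mul_self M).transpose
  have htr : (Mᴴ * M)ᵀ.trace = 1 := by
    rw [trace_transpose, Matrix.trace_mul_comm, ← h1, ← hT]
    simp [reducedState, Matrix.trace]
  have h2 : partialTraceSnd (Mᴴ * M)ᵀ = reducedState fun j k i => T i j k := by
    ext j j'
    simp [reducedState, partialTraceSnd, Matrix.mul_apply, hM, mul_comm]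
  have h3 : partialTraceFst (Mᴴ * M)ᵀ = reducedState fun k i j => T i j k := by
    ext k k'
    simp only [reducedState, partialTraceFst, Matrix.mul_apply, hM, transpose_apply, of_apply,
      conjTranspose_apply]
    rw [Finset.sum_comm]
    simp only [mul_comm]
  have h4 : vonNeumannEntropy (reducedState T) = vonNeumannEntropy (Mᴴ * M)ᵀ := by
    rw [vonNeumannEntropy_transpose (isHermitian_conjTranspose_mul_self M), h1,
      vonNeumannEntropy_mul_comm M Mᴴ (isHermitian_mul_conjTranspose_self M)
        (isHermitian_conjTranspose_mul_self M)]
  rw [h4, ← h2, ← h3]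
  exact vonNeumannEntropy_subadditive hps htr

end Tripartite

/-! ### Kraus operators and maximally entangled vectors -/

theorem tensorMap_eq_sum {β γ : Type*} [Fintype β] [DecidableEq β] [Fintype γ] [DecidableEq γ]
    {κ ν : Type*} [Fintype κ] [Fintype ν]
    {Φ : Matrix β β ℂ →ₗ[ℂ] Matrix β β ℂ} {Ψ : Matrix γ γ ℂ →ₗ[ℂ] Matrix γ γ ℂ}
    {A : κ → Matrix β β ℂ} {B : ν → Matrix γ γ ℂ}
    (hA : ∀ X, Φ X = ∑ k, A k * X * (A k)ᴴ) (hB : ∀ X, Ψ X = ∑ l, B l * X * (B l)ᴴ)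
    (X : Matrix (β × γ) (β × γ) ℂ) :
    tensorMap Φ Ψ X = ∑ k, ∑ l, (A k ⊗ₖ B l) * X * (A k ⊗ₖ B l)ᴴ := by
  induction X using kronecker_induction with
  | h0 => simp
  | hk X Y =>
    rw [tensorMap_kronecker, hA, hB]
    simp only [conjTranspose_kronecker, ← mul_kronecker_mul]
    ext ⟨i, j⟩ ⟨i', j'⟩
    simp only [kronecker_apply, Matrix.sum_apply, Finset.sum_mul_sum]
  | hadd X Y hX hY => simp only [map_add, hX, hY, mul_add, add_mul, Finset.sum_add_distrib]

theorem ketbra_posSemidef {ι : Type*} [Fintype ι] (ψ : ι → ℂ) : (ketbra ψ).PosSemidef :=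
  posSemidef_vecMulVec_self_star ψ

theorem conjTranspose_transpose_comm {ι κ : Type*} (A : Matrix ι κ ℂ) : Aᴴᵀ = Aᵀᴴ := rfl

theorem mul_ketbra_mul_conjTranspose {ι κ : Type*} [Fintype ι] [Fintype κ] (A : Matrix κ ι ℂ)
    (ψ : ι → ℂ) : A * ketbra ψ * Aᴴ = ketbra (A *ᵥ ψ) := by
  rw [ketbra, ketbra, mul_vecMulVec, vecMulVec_mul, star_mulVec]

/-- Reshaping vectors into matrices turns the local operators into left and right multiplications,
so that marginals become traces of matrix products. -/
theorem kronecker_mulVec_apply {β γ : Type*} [Fintype β] [Fintype γ] (A : Matrix β β ℂ)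
    (B : Matrix γ γ ℂ) (ψ : β × γ → ℂ) (r : β × γ) :
    ((A ⊗ₖ B) *ᵥ ψ) r = (A * Matrix.of (fun b c => ψ (b, c)) * Bᵀ) r.1 r.2 := by
  simp only [mulVec, dotProduct, kroneckerMap_apply, Matrix.mul_apply, of_apply, transpose_apply,
    Fintype.sum_prod_type, Finset.sum_mul]
  rw [Finset.sum_comm]
  exact Finset.sum_congr rfl fun _ _ => Finset.sum_congr rfl fun _ _ => by ring

section Kraus

variable {n : ℕ}

theorem ketbra_phiPlus : ketbra (phiPlus n) =
    (n : ℂ)⁻¹ • ∑ b : Fin n, ∑ b' : Fin n, (single b b' (1 : ℂ)) ⊗ₖ (single b b' (1 : ℂ)) := by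
  have hs : ((1 / Real.sqrt n : ℝ) : ℂ) * ((1 / Real.sqrt n : ℝ) : ℂ) = (n : ℂ)⁻¹ := by
    rw [← Complex.ofReal_mul, div_mul_div_comm, Real.mul_self_sqrt (Nat.cast_nonneg n)]
    simp
  ext ⟨i, j⟩ ⟨i', j'⟩
  simp only [ketbra, phiPlus, vecMulVec_apply, Pi.star_apply, Matrix.smul_apply, Matrix.sum_apply,
    kronecker_apply, single_apply, smul_eq_mul]
  rw [Finset.sum_eq_single i, Finset.sum_eq_single i']
  · by_cases h : i = j <;> by_cases h' : i' = j' <;> simp [h, h', -one_div]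
    simpa [h, h'] using hs
  · intro b _ hb; simp [hb]
  · simp
  · intro b _ hb; simp [hb]
  · simp

theorem jamiolkowskiState_apply
    (Φ : Matrix (Fin n) (Fin n) ℂ →ₗ[ℂ] Matrix (Fin n) (Fin n) ℂ) (a b a' b' : Fin n) :
    jamiolkowskiState Φ (a, b) (a', b') = (n : ℂ)⁻¹ * Φ (single b b' 1) a a' := by
  simp only [jamiolkowskiState, ketbra_phiPlus, map_smul, map_sum, tensorMap_kronecker,
    LinearMap.id_apply, Matrix.smul_apply, Matrix.sum_apply, kronecker_apply, single_apply, smul_eq_mul]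
  rw [Finset.sum_eq_single b, Finset.sum_eq_single b']
  · simp
  · intro c _ hc; simp [hc]
  · simp
  · intro c _ hc; simp [hc]
  · simp

/-- A channel has a Kraus decomposition, whose Gram matrix has entropy the map entropy. -/
theorem IsChannel.exists_kraus (hn : n ≠ 0)
    {Φ : Matrix (Fin n) (Fin n) ℂ →ₗ[ℂ] Matrix (Fin n) (Fin n) ℂ} (hΦ : IsChannel Φ) :
    ∃ (m : ℕ) (A : Fin m → Matrix (Fin n) (Fin n) ℂ),
      (∀ X, Φ X = ∑ k, A k * X * (A k)ᴴ) ∧ ∑ k, (A k)ᴴ * A k = 1 ∧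
      mapEntropy Φ =
        vonNeumannEntropy (Matrix.of fun k k' => (n : ℂ)⁻¹ * (A k * (A k')ᴴ).trace) := by
  have hn' : (n : ℂ) ≠ 0 := Nat.cast_ne_zero.mpr hn
  have hs : (Real.sqrt n : ℂ) * (Real.sqrt n : ℂ) = n := by
    rw [← Complex.ofReal_mul, Real.mul_self_sqrt (Nat.cast_nonneg n)]
    simp
  have hps : (jamiolkowskiState Φ).PosSemidef := hΦ.completelyPositive n _ (ketbra_posSemidef _)
  obtain ⟨m, v, hv⟩ := posSemidef_iff_eq_sum_vecMulVec.mp hps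
  set M : Matrix (Fin n × Fin n) (Fin m) ℂ := Matrix.of fun p k => v k p with hMdef
  have hM : jamiolkowskiState Φ = M * Mᴴ := by
    rw [hv]
    ext p p'
    simp [Matrix.sum_apply, vecMulVec_apply, Matrix.mul_apply, hMdef]
  -- Each vector in the rank-one decomposition is reshaped into a matrix; the factor `√n` cancels
  -- the `1/n` of `|φ₊⟩⟨φ₊|`.
  set A : Fin m → Matrix (Fin n) (Fin n) ℂ :=
    fun k => Matrix.of fun a b => (Real.sqrt n : ℂ) * M (a, b) k with hA
  have hentry : ∀ a b a' b', Φ (single b b' 1) a a' = ∑ k, A k a b * star (A k a' b') := by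
    intro a b a' b'
    have h := jamiolkowskiState_apply Φ a b a' b'
    rw [hM, Matrix.mul_apply] at h
    rw [← mul_right_inj' (inv_ne_zero hn'), ← h, Finset.mul_sum]
    refine Finset.sum_congr rfl fun k _ => ?_
    simp only [hA, of_apply, conjTranspose_apply, star_mul', RCLike.star_def, Complex.conj_ofReal]
    rw [mul_mul_mul_comm, hs, inv_mul_cancel_left₀ hn']
  have hKraus : ∀ X, Φ X = ∑ k, A k * X * (A k)ᴴ := by
    intro X
    conv_lhs => rw [matrix_eq_sum_single X]
    have : ∀ b b', single b b' (X b b') = X b b' • single b b' (1 : ℂ) := fun b b' => by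
      rw [smul_single]; simp
    ext a a'
    simp only [this, map_sum, map_smul, Matrix.sum_apply, Matrix.smul_apply, hentry, smul_eq_mul,
      Matrix.mul_apply, conjTranspose_apply, Finset.sum_mul, Finset.mul_sum]
    rw [Finset.sum_comm]
    conv_rhs => rw [Finset.sum_comm]
    refine Finset.sum_congr rfl fun b' _ => ?_
    rw [Finset.sum_comm]
    exact Finset.sum_congr rfl fun k _ => Finset.sum_congr rfl fun b _ => by ring
  refine ⟨m, A, hKraus, ?_, ?_⟩
  · refine ext_iff_trace_mul_right.mpr fun X => ?_
    rw [one_mul, ← hΦ.trace_preserving X, hKraus, Finset.sum_mul, trace_sum, trace_sum]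
    refine Finset.sum_congr rfl fun k _ => ?_
    rw [mul_assoc, Matrix.trace_mul_comm]
  · rw [mapEntropy, hM, vonNeumannEntropy_mul_comm M Mᴴ (isHermitian_mul_conjTranspose_self M)
      (isHermitian_conjTranspose_mul_self M),
      ← vonNeumannEntropy_transpose (isHermitian_conjTranspose_mul_self M)]
    congr 1
    ext k k'
    simp only [transpose_apply, Matrix.mul_apply, conjTranspose_apply, Matrix.trace, diag_apply,
      Fintype.sum_prod_type, of_apply, Finset.mul_sum, hA, star_mul', RCLike.star_def,
      Complex.conj_ofReal]
    refine Finset.sum_congr rfl fun a _ => Finset.sum_congr rfl fun b _ => ?_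
    rw [mul_mul_mul_comm, hs, inv_mul_cancel_left₀ hn', mul_comm]

/-- The coefficient matrix of a maximally entangled vector is a multiple of a unitary. -/
theorem IsMaximallyEntangled.mul_conjTranspose {ψ : Fin n × Fin n → ℂ}
    (hψ : IsMaximallyEntangled ψ) :
    (Matrix.of fun b c => ψ (b, c)) * (Matrix.of fun b c => ψ (b, c))ᴴ =
      (n : ℂ)⁻¹ • (1 : Matrix (Fin n) (Fin n) ℂ) := by
  obtain ⟨e, f, h⟩ := hψ
  have hs : ((1 / Real.sqrt n : ℝ) : ℂ) * ((1 / Real.sqrt n : ℝ) : ℂ) = (n : ℂ)⁻¹ := by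
    rw [← Complex.ofReal_mul, div_mul_div_comm, Real.mul_self_sqrt (Nat.cast_nonneg n)]
    simp
  have hU : ∀ g : OrthonormalBasis (Fin n) ℂ (EuclideanSpace ℂ (Fin n)),
      (Matrix.of fun b k => g k b)ᴴ * (Matrix.of fun b k => g k b) = 1 := fun g => by
    ext k k'
    have := orthonormal_iff_ite.mp g.orthonormal k k'
    simpa [Matrix.mul_apply, one_apply, PiLp.inner_apply, mul_comm] using this
  set E : Matrix (Fin n) (Fin n) ℂ := Matrix.of fun b k => e k b with hE
  set F : Matrix (Fin n) (Fin n) ℂ := Matrix.of fun b k => f k b with hF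
  have hΨ : (Matrix.of fun b c => ψ (b, c)) = ((1 / Real.sqrt n : ℝ) : ℂ) • (E * Fᵀ) := by
    ext b c
    simp [h, Matrix.mul_apply, hE, hF]
  have hFt : Fᵀ * (Fᵀ)ᴴ = 1 := by
    have := congrArg transpose (hU f)
    rwa [transpose_mul, transpose_one, conjTranspose_transpose_comm] at this
  rw [hΨ, conjTranspose_smul, smul_mul_smul_comm, conjTranspose_mul, mul_assoc,
    ← mul_assoc Fᵀ, hFt, one_mul, mul_eq_one_comm.mp (hU e), RCLike.star_def, Complex.conj_ofReal,
    hs]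

end Kraus

end QuantumChannel

theorem proposition3 (n : ℕ)
    (Φ₁ Φ₂ : Matrix (Fin n) (Fin n) ℂ →ₗ[ℂ] Matrix (Fin n) (Fin n) ℂ)
    (hΦ₁ : QuantumChannel.IsChannel Φ₁) (hΦ₂ : QuantumChannel.IsChannel Φ₂)
    (ψ : Fin n × Fin n → ℂ) (hψ : QuantumChannel.IsMaximallyEntangled ψ) :
    |QuantumChannel.mapEntropy Φ₁ - QuantumChannel.mapEntropy Φ₂| ≤
        QuantumChannel.vonNeumannEntropy
          (QuantumChannel.tensorMap Φ₁ Φ₂ (QuantumChannel.ketbra ψ)) ∧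
      QuantumChannel.vonNeumannEntropy
          (QuantumChannel.tensorMap Φ₁ Φ₂ (QuantumChannel.ketbra ψ)) ≤
        QuantumChannel.mapEntropy Φ₁ + QuantumChannel.mapEntropy Φ₂ := by
  open QuantumChannel Matrix in
  rcases eq_or_ne n 0 with rfl | hn
  -- For `n = 0` the matrices are empty and every entropy is 0.
  · simp [mapEntropy, vonNeumannEntropy, Matrix.trace]
  have hn' : (n : ℂ) ≠ 0 := Nat.cast_ne_zero.mpr hn
  obtain ⟨m₁, A, hA, hA1, hSA⟩ := hΦ₁.exists_kraus hn
  obtain ⟨m₂, B, hB, hB1, hSB⟩ := hΦ₂.exists_kraus hn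
  set Ψ : Matrix (Fin n) (Fin n) ℂ := Matrix.of fun b c => ψ (b, c) with hΨdef
  have hΨ1 : Ψ * Ψᴴ = (n : ℂ)⁻¹ • 1 := hψ.mul_conjTranspose
  have hΨ2 : Ψᴴ * Ψ = (n : ℂ)⁻¹ • 1 := by
    have h : (n : ℂ) • Ψ * Ψᴴ = 1 := by rw [smul_mul_assoc, hΨ1, smul_inv_smul₀ hn']
    have h' := mul_eq_one_comm.mp h
    rw [mul_smul_comm] at h'
    rw [← h', inv_smul_smul₀ hn']
  have hB1' : ∑ l, (B l)ᵀ * ((B l)ᵀ)ᴴ = 1 := by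
    have := congrArg transpose hB1
    simpa only [transpose_sum, transpose_mul, transpose_one, conjTranspose_transpose_comm]
      using this
  set W : Fin n × Fin n → Fin m₁ → Fin m₂ → ℂ :=
    fun r k l => (A k * Ψ * (B l)ᵀ) r.1 r.2 with hW
  have htr : ∀ X Y : Matrix (Fin n) (Fin n) ℂ,
      ∑ r : Fin n × Fin n, X r.1 r.2 * star (Y r.1 r.2) = (X * Yᴴ).trace := fun X Y => by
    simp [Matrix.trace, Matrix.mul_apply, Fintype.sum_prod_type]
  have h1 : tensorMap Φ₁ Φ₂ (ketbra ψ) = reducedState W := by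
    rw [tensorMap_eq_sum hA hB]
    ext r r'
    simp only [mul_ketbra_mul_conjTranspose]
    simp only [Matrix.sum_apply, reducedState, of_apply, ketbra, vecMulVec_apply, Pi.star_apply, kronecker_mulVec_apply, hW, hΨdef]
  have h2 : reducedState (fun k l r => W r k l) =
      Matrix.of fun k k' => (n : ℂ)⁻¹ * (A k * (A k')ᴴ).trace := by
    ext k k'
    simp only [reducedState, of_apply, hW, htr, conjTranspose_mul]
    -- Summing over `l` removes `B` by trace preservation of `Φ₂`; then `Ψ * Ψᴴ` is scalar.
    have : ∀ l, A k * Ψ * (B l)ᵀ * (((B l)ᵀ)ᴴ * (Ψᴴ * (A k')ᴴ)) =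
        A k * Ψ * ((B l)ᵀ * ((B l)ᵀ)ᴴ) * (Ψᴴ * (A k')ᴴ) := fun l => by simp only [mul_assoc]
    simp only [this]
    rw [← trace_sum, ← Finset.sum_mul, ← Finset.mul_sum, hB1', mul_one, mul_assoc, ← mul_assoc Ψ,
      hΨ1, smul_mul_assoc, one_mul, mul_smul_comm, trace_smul, smul_eq_mul]
  have h3 : reducedState (fun l r k => W r k l) =
      Matrix.of fun l l' => (n : ℂ)⁻¹ * (B l * (B l')ᴴ).trace := by
    ext l l'
    simp only [reducedState, of_apply, hW]
    rw [Finset.sum_comm]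
    simp only [htr, conjTranspose_mul]
    -- Cyclicity brings `(A k)ᴴ` next to `A k`, so the sum over `k` is removed by trace preservation
    -- of `Φ₁`; here `Ψᴴ * Ψ` is the scalar needed.
    have : ∀ k, (A k * Ψ * (B l)ᵀ * (((B l')ᵀ)ᴴ * (Ψᴴ * (A k)ᴴ))).trace =
        (((A k)ᴴ * A k) * (Ψ * (B l)ᵀ * (((B l')ᵀ)ᴴ * Ψᴴ))).trace := fun k => by
      rw [mul_assoc ((A k)ᴴ), Matrix.trace_mul_comm ((A k)ᴴ)]
      simp only [mul_assoc]
    simp only [this]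
    rw [← trace_sum, ← Finset.sum_mul, hA1, one_mul, ← mul_assoc, Matrix.trace_mul_comm,
      mul_assoc Ψ, ← mul_assoc Ψᴴ, hΨ2, smul_mul_assoc, one_mul, trace_smul, smul_eq_mul,
      ← trace_transpose, transpose_mul, conjTranspose_transpose_comm, transpose_transpose,
      transpose_transpose, Matrix.trace_mul_comm]
  have hone : ∑ k, ∑ l, ∑ r, W r k l * star (W r k l) = 1 := by
    have : ∀ k, ∑ l, ∑ r, W r k l * star (W r k l) = (n : ℂ)⁻¹ * ((A k)ᴴ * A k).trace := fun k => by
      rw [Matrix.trace_mul_comm]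
      exact congrFun (congrFun h2 k) k
    simp only [this]
    rw [← Finset.mul_sum, ← trace_sum, hA1, trace_one, Fintype.card_fin, inv_mul_cancel₀ hn']
  have hone1 : ∑ r, ∑ k, ∑ l, W r k l * star (W r k l) = 1 := by
    rw [← hone, Finset.sum_comm]
    exact Finset.sum_congr rfl fun k _ => Finset.sum_comm
  have hone3 : ∑ l, ∑ r, ∑ k, W r k l * star (W r k l) = 1 := by
    rw [← hone1, Finset.sum_comm]
    exact Finset.sum_congr rfl fun k _ => Finset.sum_comm
  -- The output as the single party gives the upper bound; each environment in turn gives one sign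
  -- of the absolute value.
  have i1 := vonNeumannEntropy_reducedState_le W hone1
  have i2 := vonNeumannEntropy_reducedState_le (fun k l r => W r k l) hone
  have i3 := vonNeumannEntropy_reducedState_le (fun l r k => W r k l) hone3
  rw [h2, h3, ← hSA, ← hSB, ← h1] at i1 i2 i3
  refine ⟨abs_le.mpr ⟨?_, ?_⟩, ?_⟩ <;> linarith
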